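/- Let $H$ be a complex separable Hilbert space and let $A, B$ be compact operators on $H$. For a bounded operator $T$ write $|T| = (T^*T)^{1/2}$, and for a compact operator $T$ let $s_1(T) \ge s_2(T) \ge \cdots$ denote its singular values, i.e. the eigenvalues of $|T|$ in decreasing order, repeated according to multiplicity (with $s_j(T) = 0$ if $|T|$ has fewer than $j$ positive eigenvalues). For operators $S, T$ on $H$ let $S \oplus T$ denote the block diagonal operator $\begin{bmatrix} S & 0 \\ 0 & T \end{bmatrix}$ on the Hilbert space $H \oplus H$. Then $$s_j(A+B) \le s_j\bigl((|A|+|B|) \oplus (|A^*|+|B^*|)\bigr) \qquad \text{for all } j = 1, 2, \ldots$$ -/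

import Mathlib

noncomputable section

namespace SingularValueSum

/-- The block diagonal operator `A ⊕ B` on the Hilbert space direct sum `H ⊕ H`,
i.e. `(x, y) ↦ (A x, B y)`, where `H ⊕ H` carries the inner product
`⟪(x, y), (x', y')⟫ = ⟪x, x'⟫ + ⟪y, y'⟫`. -/
def directSum {H : Type*} [NormedAddCommGroup H] [InnerProductSpace ℂ H]
    (A B : H →L[ℂ] H) : WithLp 2 (H × H) →L[ℂ] WithLp 2 (H × H) :=
  (WithLp.prodContinuousLinearEquiv 2 ℂ H H).symm.toContinuousLinearMap ∘L (A.prodMap B) ∘L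
    (WithLp.prodContinuousLinearEquiv 2 ℂ H H).toContinuousLinearMap

/-- The number of real eigenvalues of `T` that are at least `t`, each counted with its
multiplicity: the dimension of the (automatically direct) sum of the eigenspaces
`ker (T - μ)` over all real `μ ≥ t`. -/
def eigenvalueCount {E : Type*} [NormedAddCommGroup E] [InnerProductSpace ℂ E]
    (T : E →L[ℂ] E) (t : ℝ) : Cardinal :=
  Module.rank ℂ (⨆ μ : Set.Ici t,
    Module.End.eigenspace (T : Module.End ℂ E) ((μ : ℝ) : ℂ) : Submodule ℂ E)

/-- The `j`-th singular value (`j = 1, 2, …`) of a compact operator `A`: the `j`-th largest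
eigenvalue of the positive operator `|A| = (A* A)^{1/2}`, eigenvalues being repeated according to
multiplicity. It is the largest `t > 0` such that `|A|` has at least `j` eigenvalues in
`[t, ∞)`, counted with multiplicity, and it is `0` (the supremum of the empty set) if `|A|` has
fewer than `j` positive eigenvalues. -/
def singularValue {E : Type*} [NormedAddCommGroup E] [InnerProductSpace ℂ E] [CompleteSpace E]
    (A : E →L[ℂ] E) (j : ℕ) : ℝ :=
  sSup {t : ℝ | 0 < t ∧ (j : Cardinal) ≤ eigenvalueCount (CFC.abs A) t}

end SingularValueSum

end

/-! Write `X = A + B` and `T = (|A|+|B|) ⊕ (|A*|+|B*|)`. The self-adjoint block operator `(x, y) ↦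
(A* y, A x)` has absolute value `|A| ⊕ |A*|` and lies below it, which is the mixed Schwarz
inequality `2 Re⟪A x, y⟫ ≤ ⟪|A| x, x⟫ + ⟪|A*| y, y⟫` (`two_mul_re_inner_le`). For `u` in the
spectral subspace of `|X|` for `[t, ∞)`, put `y = |X| u` and add the inequalities for `A` and `B` at
`(y, X u)`. The form of `T` there is at least `2 Re⟪X y, X u⟫ = 2⟪|X| y, y⟫ ≥ 2t‖y‖² = t‖(y, X
u)‖²`. Since `u ↦ (|X| u, X u)` is injective there, minimax (`le_eigenvalueCount`) gives `T` at
least as many eigenvalues in `[t, ∞)` as `|X|`. -/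

open scoped InnerProductSpace ComplexOrder
open Module.End

namespace SingularValueSum

/-! ### Quadratic forms on spectral subspaces, and minimax. -/

section Forms

variable {E : Type*} [NormedAddCommGroup E] [InnerProductSpace ℂ E]

/-- An affine expression in the quadratic form of a symmetric operator is nonnegative on a sum of
eigenspaces as soon as it is nonnegative at each of the eigenvalues involved. -/
theorem nonneg_form_of_mem_iSup_eigenspace {T : E →ₗ[ℂ] E} (hT : T.IsSymmetric) {s : Set ℂ}
    {a b : ℝ} (h : ∀ μ ∈ s, HasEigenvalue T μ → 0 ≤ a * μ.re + b) {x : E}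
    (hx : x ∈ (⨆ μ : s, eigenspace T (μ : ℂ) : Submodule ℂ E)) :
    0 ≤ a * (⟪T x, x⟫_ℂ).re + b * ‖x‖ ^ 2 := by
  obtain ⟨f, hf, rfl⟩ := (Submodule.mem_iSup_iff_exists_finsupp _ _).1 hx
  have hO : OrthogonalFamily ℂ (fun μ : s => eigenspace T (μ : ℂ))
      fun μ => (eigenspace T (μ : ℂ)).subtypeₗᵢ :=
    hT.orthogonalFamily_eigenspaces.comp Subtype.coe_injective
  have hTf : T (f.sum fun _ y => y) = ∑ i ∈ f.support, (i : ℂ) • f i := by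
    rw [Finsupp.sum, map_sum]
    exact Finset.sum_congr rfl fun i _ => mem_eigenspace_iff.1 (hf i)
  have h1 : ⟪T (f.sum fun _ y => y), f.sum fun _ y => y⟫_ℂ =
      ∑ i ∈ f.support, ⟪(i : ℂ) • f i, f i⟫_ℂ := by
    rw [hTf]
    exact hO.inner_sum (fun i => ⟨(i : ℂ) • f i, Submodule.smul_mem _ _ (hf i)⟩)
      (fun i => ⟨f i, hf i⟩) f.support
  have h2 : ‖f.sum fun _ y => y‖ ^ 2 = ∑ i ∈ f.support, ‖f i‖ ^ 2 :=
    hO.norm_sum (fun i => ⟨f i, hf i⟩) f.support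
  have h3 : ∀ i : s, (⟪(i : ℂ) • f i, f i⟫_ℂ).re = (i : ℂ).re * ‖f i‖ ^ 2 := by
    intro i
    rw [inner_smul_left, inner_self_eq_norm_sq_to_K]
    norm_cast
    simp [-Complex.ofReal_pow]
  rw [h1, h2, Complex.re_sum, Finset.mul_sum, Finset.mul_sum, ← Finset.sum_add_distrib]
  refine Finset.sum_nonneg fun i hi => ?_
  rw [h3, ← mul_assoc, ← add_mul]
  refine mul_nonneg (h i i.2 ?_) (by positivity)
  exact hasEigenvalue_of_hasEigenvector ⟨hf i, Finsupp.mem_support_iff.1 hi⟩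

/-- The sum of the eigenspaces of `T` for the real eigenvalues that are at least `t`. -/
abbrev eigenspaceGE (T : E →L[ℂ] E) (t : ℝ) : Submodule ℂ E :=
  ⨆ μ : Set.Ici t, eigenspace (T : Module.End ℂ E) ((μ : ℝ) : ℂ)

theorem le_form_of_mem_eigenspaceGE {T : E →L[ℂ] E} (hT : (T : E →ₗ[ℂ] E).IsSymmetric) {t : ℝ}
    {x : E} (hx : x ∈ eigenspaceGE T t) : t * ‖x‖ ^ 2 ≤ (⟪T x, x⟫_ℂ).re := by
  have hle : eigenspaceGE T t ≤
      ⨆ μ : {z : ℂ | t ≤ z.re}, eigenspace (T : Module.End ℂ E) (μ : ℂ) :=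
    iSup_le fun μ => le_iSup (fun μ : {z : ℂ | t ≤ z.re} =>
      eigenspace (T : Module.End ℂ E) (μ : ℂ)) ⟨((μ : ℝ) : ℂ), by
        have : t ≤ (μ : ℝ) := μ.2
        simpa using this⟩
  have := nonneg_form_of_mem_iSup_eigenspace hT (a := 1) (b := -t)
    (fun μ hμ _ => by have : t ≤ μ.re := hμ; linarith) (hle hx)
  simp only [ContinuousLinearMap.coe_coe] at this
  linarith

theorem map_mem_eigenspaceGE {T : E →L[ℂ] E} {t : ℝ} {x : E} (hx : x ∈ eigenspaceGE T t) :
    T x ∈ eigenspaceGE T t := by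
  have : eigenspaceGE T t ≤ (eigenspaceGE T t).comap (T : E →ₗ[ℂ] E) := by
    refine iSup_le fun μ y hy => ?_
    have h : T y = ((μ : ℝ) : ℂ) • y := mem_eigenspace_iff.1 hy
    rw [Submodule.mem_comap, ContinuousLinearMap.coe_coe, h]
    exact Submodule.smul_mem _ _ (Submodule.mem_iSup_of_mem μ hy)
  exact this hx

theorem map_mem_orthogonal_eigenspaceGE {T : E →L[ℂ] E} (hT : (T : E →ₗ[ℂ] E).IsSymmetric) {t : ℝ}
    {x : E} (hx : x ∈ (eigenspaceGE T t)ᗮ) : T x ∈ (eigenspaceGE T t)ᗮ := by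
  intro y hy
  have := hx (T y) (map_mem_eigenspaceGE hy)
  rw [← this]
  exact (hT y x).symm

variable [CompleteSpace E]

/-- The form equals `‖P^{1/2} x‖²`. Applied to `t - T`, this turns equality in a form bound into an
eigenvector. -/
theorem apply_eq_zero_of_nonneg_of_form_eq_zero {P : E →L[ℂ] E} (hP : 0 ≤ P) {x : E}
    (hx : (⟪P x, x⟫_ℂ).re = 0) : P x = 0 := by
  have hQ : 0 ≤ CFC.sqrt P := CFC.sqrt_nonneg P
  have hQs := ((ContinuousLinearMap.nonneg_iff_isPositive _).1 hQ).isSymmetric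
  have hQQ : CFC.sqrt P (CFC.sqrt P x) = P x := by
    rw [← mul_apply_eq_comp, CFC.sqrt_mul_sqrt_self P hP]
  have h1 : ⟪P x, x⟫_ℂ = ⟪CFC.sqrt P x, CFC.sqrt P x⟫_ℂ := by
    rw [← hQQ]
    exact hQs _ _
  rw [h1] at hx
  have h2 : CFC.sqrt P x = 0 := by
    have h3 : ‖CFC.sqrt P x‖ ^ 2 = 0 := by
      rw [← hx, ← inner_self_eq_norm_sq (𝕜 := ℂ)]
      rfl
    simpa using h3
  rw [← hQQ, h2, map_zero]

/-- A quadratic form bound that holds for every eigenvalue of a compact symmetric operator. -/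
theorem form_le_of_forall_eigenvalue_le {T : E →L[ℂ] E} (hc : IsCompactOperator T)
    (hT : (T : E →ₗ[ℂ] E).IsSymmetric) {t : ℝ}
    (h : ∀ μ, HasEigenvalue (T : Module.End ℂ E) μ → μ.re ≤ t) (x : E) :
    (⟪T x, x⟫_ℂ).re ≤ t * ‖x‖ ^ 2 := by
  have hd : Dense ((⨆ μ, eigenspace (T : Module.End ℂ E) μ : Submodule ℂ E) : Set E) :=
    (Submodule.dense_iff_topologicalClosure_eq_top).2
      ((Submodule.topologicalClosure_eq_top_iff).2
        (ContinuousLinearMap.orthogonalComplement_iSup_eigenspaces_eq_bot hc hT))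
  have hcl : IsClosed {x : E | (⟪T x, x⟫_ℂ).re ≤ t * ‖x‖ ^ 2} :=
    isClosed_le (by fun_prop) (by fun_prop)
  suffices hsub : ((⨆ μ, eigenspace (T : Module.End ℂ E) μ : Submodule ℂ E) : Set E) ⊆
      {x : E | (⟪T x, x⟫_ℂ).re ≤ t * ‖x‖ ^ 2} from closure_minimal hsub hcl (hd x)
  intro y hy
  have hy' : y ∈ (⨆ μ : (Set.univ : Set ℂ), eigenspace (T : Module.End ℂ E) (μ : ℂ) :
      Submodule ℂ E) := by
    refine (iSup_le fun μ => ?_ : (⨆ μ, eigenspace (T : Module.End ℂ E) μ) ≤ _) hy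
    exact le_iSup (fun μ : (Set.univ : Set ℂ) => eigenspace (T : Module.End ℂ E) (μ : ℂ))
      ⟨μ, trivial⟩
  have := nonneg_form_of_mem_iSup_eigenspace hT (a := -1) (b := t)
    (fun μ _ hμ => by linarith [h μ hμ]) hy'
  simp only [ContinuousLinearMap.coe_coe] at this
  show (⟪T y, y⟫_ℂ).re ≤ t * ‖y‖ ^ 2
  linarith

/-- Strict version of `form_le_of_forall_eigenvalue_le`. -/
theorem form_lt_of_forall_eigenvalue_lt {T : E →L[ℂ] E} (hc : IsCompactOperator T)
    (hT : (T : E →ₗ[ℂ] E).IsSymmetric) {t : ℝ}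
    (h : ∀ μ, HasEigenvalue (T : Module.End ℂ E) μ → μ.re < t) {x : E} (hx : x ≠ 0) :
    (⟪T x, x⟫_ℂ).re < t * ‖x‖ ^ 2 := by
  have hle := form_le_of_forall_eigenvalue_le hc hT fun μ hμ => (h μ hμ).le
  -- Equality would make `x` a null vector of the form of `t - T ≥ 0`, hence an eigenvector for the
  -- excluded eigenvalue `t`.
  refine lt_of_le_of_ne (hle x) fun heq => ?_
  have hform : ∀ y, (⟪((t : ℂ) • (1 : E →L[ℂ] E) - T) y, y⟫_ℂ).re =
      t * ‖y‖ ^ 2 - (⟪T y, y⟫_ℂ).re := by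
    intro y
    simp only [sub_apply, smul_apply, one_apply_eq_self, inner_sub_left,
      inner_smul_left, inner_self_eq_norm_sq_to_K, Complex.sub_re, Complex.conj_ofReal]
    norm_cast
    simp [-Complex.ofReal_pow]
  have hpos : 0 ≤ (t : ℂ) • (1 : E →L[ℂ] E) - T := by
    rw [ContinuousLinearMap.nonneg_iff_isPositive]
    refine ⟨?_, fun y => ?_⟩
    · intro y z
      have := hT y z
      simp only [ContinuousLinearMap.coe_coe] at this
      simp [inner_sub_left, inner_sub_right, this]
    · have := hform y
      rw [ContinuousLinearMap.reApplyInnerSelf_apply]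
      have h2 := hle y
      show 0 ≤ (⟪((t : ℂ) • (1 : E →L[ℂ] E) - T) y, y⟫_ℂ).re
      linarith
  have h0 := apply_eq_zero_of_nonneg_of_form_eq_zero hpos (x := x) (by rw [hform]; linarith)
  have hTx : T x = (t : ℂ) • x := by
    simpa [sub_eq_zero, eq_comm (a := T x)] using h0
  have := h t (hasEigenvalue_of_hasEigenvector ⟨mem_eigenspace_iff.2 hTx, hx⟩)
  simp at this

/-- The restriction of `T` to the complement is compact symmetric; an eigenvector of it with
eigenvalue at least `t` would be orthogonal to itself. -/
theorem form_lt_of_mem_orthogonal_eigenspaceGE {T : E →L[ℂ] E} (hc : IsCompactOperator T)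
    (hT : (T : E →ₗ[ℂ] E).IsSymmetric) {t : ℝ} {x : E} (hx : x ∈ (eigenspaceGE T t)ᗮ)
    (hx0 : x ≠ 0) : (⟪T x, x⟫_ℂ).re < t * ‖x‖ ^ 2 := by
  have hinv : ∀ y ∈ (eigenspaceGE T t)ᗮ, T y ∈ (eigenspaceGE T t)ᗮ :=
    fun y hy => map_mem_orthogonal_eigenspaceGE hT hy
  let S : (eigenspaceGE T t)ᗮ →L[ℂ] (eigenspaceGE T t)ᗮ := T.restrict hinv
  have hSc : IsCompactOperator S := IsCompactOperator.restrict' hc hinv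
  have hSs : (S : (eigenspaceGE T t)ᗮ →ₗ[ℂ] (eigenspaceGE T t)ᗮ).IsSymmetric :=
    hT.restrict_invariant hinv
  refine form_lt_of_forall_eigenvalue_lt hSc hSs (x := ⟨x, hx⟩) (fun μ hμ => ?_) (by simpa using hx0)
  by_contra! hle
  have hre : ((μ.re : ℝ) : ℂ) = μ := Complex.conj_eq_iff_re.1 (hSs.conj_eigenvalue_eq_self hμ)
  obtain ⟨v, hv, hv0⟩ := hμ.exists_hasEigenvector
  have hTv : T (v : E) = μ • (v : E) := congrArg Subtype.val (mem_eigenspace_iff.1 hv)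
  have hmem : (v : E) ∈ eigenspaceGE T t := by
    refine Submodule.mem_iSup_of_mem (⟨μ.re, hle⟩ : Set.Ici t) (mem_eigenspace_iff.2 ?_)
    simpa [hre] using hTv
  exact hv0 (Subtype.ext (inner_self_eq_zero.1 (v.2 _ hmem)))

/-- Half of the minimax principle: a space on which the form of a compact symmetric operator is
at least `t` bounds the number of eigenvalues in `[t, ∞)` from below. -/
theorem le_eigenvalueCount {F : Type*} [AddCommGroup F] [Module ℂ F] {T : E →L[ℂ] E}
    (hc : IsCompactOperator T) (hT : (T : E →ₗ[ℂ] E).IsSymmetric) {t : ℝ} {L : F →ₗ[ℂ] E}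
    (hL : Function.Injective L) (hform : ∀ u, t * ‖L u‖ ^ 2 ≤ (⟪T (L u), L u⟫_ℂ).re) {j : ℕ}
    (hj : (j : Cardinal) ≤ Module.rank ℂ F) : (j : Cardinal) ≤ eigenvalueCount T t := by
  by_contra! hlt
  have hfin : FiniteDimensional ℂ (eigenspaceGE T t) :=
    Module.rank_lt_aleph0_iff.1 (hlt.trans Cardinal.natCast_lt_aleph0)
  -- A nonzero vector of the range of `L` killed by the projection would have form both `≥ t‖·‖²`
  -- and `< t‖·‖²`.
  let f : F →ₗ[ℂ] eigenspaceGE T t := ((eigenspaceGE T t).orthogonalProjectionOnto).toLinearMap ∘ₗ L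
  have hf : Function.Injective f := by
    rw [injective_iff_map_eq_zero]
    intro u hu
    by_contra hu0
    have hmem : L u ∈ (eigenspaceGE T t)ᗮ :=
      Submodule.orthogonalProjectionOnto_eq_zero_iff.1 hu
    have hne : L u ≠ 0 := fun h => hu0 ((map_eq_zero_iff L hL).1 h)
    exact absurd (hform u) (not_le.2 (form_lt_of_mem_orthogonal_eigenspaceGE hc hT hmem hne))
  have h1 := f.lift_rank_le_of_injective hf
  have h2 : (j : Cardinal) ≤ Cardinal.lift.{_, _} (eigenvalueCount T t) := by
    have := Cardinal.lift_le.2 hj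
    rw [Cardinal.lift_natCast] at this
    exact this.trans h1
  exact absurd (Cardinal.nat_le_lift_iff.1 h2) (not_le.2 hlt)

-- Bounds above the set whose supremum is the singular value.
omit [CompleteSpace E] in
theorem le_norm_of_one_le_eigenvalueCount {T : E →L[ℂ] E}
    (hT : (T : E →ₗ[ℂ] E).IsSymmetric) {t : ℝ} (h : 1 ≤ eigenvalueCount T t) : t ≤ ‖T‖ := by
  have hne : eigenspaceGE T t ≠ ⊥ := by
    intro hb
    have : eigenvalueCount T t = 0 := by
      show Module.rank ℂ (eigenspaceGE T t) = 0
      rw [hb, rank_bot]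
    simp [this] at h
  obtain ⟨x, hx, hx0⟩ := Submodule.exists_mem_ne_zero_of_ne_bot hne
  have h1 := le_form_of_mem_eigenspaceGE hT hx
  have h2 : (⟪T x, x⟫_ℂ).re ≤ ‖T‖ * ‖x‖ ^ 2 := by
    calc (⟪T x, x⟫_ℂ).re ≤ ‖⟪T x, x⟫_ℂ‖ := Complex.re_le_norm _
      _ ≤ ‖T x‖ * ‖x‖ := norm_inner_le_norm _ _
      _ ≤ ‖T‖ * ‖x‖ * ‖x‖ := by gcongr; exact T.le_opNorm x
      _ = ‖T‖ * ‖x‖ ^ 2 := by ring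
  have h3 : 0 < ‖x‖ ^ 2 := by positivity
  exact le_of_mul_le_mul_right (h1.trans h2) h3

/-! ### Absolute values: compactness and comparison. -/

/-- A self-adjoint operator with compact square is compact. -/
theorem isCompactOperator_of_mul_self {P : E →L[ℂ] E} (hP : (P : E →ₗ[ℂ] E).IsSymmetric)
    (hc : IsCompactOperator (P * P : E →L[ℂ] E)) : IsCompactOperator P := by
  have hK : IsCompact (closure ((P * P : E →L[ℂ] E) '' Metric.closedBall 0 1)) :=
    IsCompactOperator.isCompact_closure_image_closedBall
      (f := ((P * P : E →L[ℂ] E) : E →ₗ[ℂ] E)) hc 1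
  refine (isCompactOperator_iff_isCompact_closure_image_closedBall
    (P : E →ₗ[ℂ] E) one_pos).2 ?_
  refine TotallyBounded.isCompact_of_isClosed (TotallyBounded.closure ?_) isClosed_closure
  have hTB : TotallyBounded ((P * P : E →L[ℂ] E) '' Metric.closedBall 0 1) :=
    hK.totallyBounded.subset subset_closure
  rw [Metric.totallyBounded_iff]
  intro ε hε
  -- `‖P z‖² ≤ ‖P² z‖ ‖z‖`, and differences `z` of points of the unit ball have norm at most `2`; so
  -- an `ε²/2`-net for `P²` yields an `ε`-net for `P`.
  obtain ⟨s, hs, hfin, hcov⟩ := Metric.finite_approx_of_totallyBounded hTB (ε ^ 2 / 2) (by positivity)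
  obtain ⟨s', hs', hfin', rfl⟩ := Set.exists_subset_image_finite_and.1 ⟨s, hs, hfin, rfl⟩
  refine ⟨P '' s', hfin'.image _, ?_⟩
  rintro _ ⟨x, hx, rfl⟩
  obtain ⟨_, ⟨y, hy, rfl⟩, hxy⟩ : ∃ z ∈ (P * P : E →L[ℂ] E) '' s',
      (P * P : E →L[ℂ] E) x ∈ Metric.ball z (ε ^ 2 / 2) := by
    simpa only [Set.mem_iUnion, exists_prop] using hcov (Set.mem_image_of_mem _ hx)
  refine Set.mem_biUnion (Set.mem_image_of_mem _ hy) ?_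
  rw [mem_ball_iff_norm, ← map_sub] at hxy
  rw [ContinuousLinearMap.coe_coe, mem_ball_iff_norm, ← map_sub]
  have hd : ‖x - y‖ ≤ 2 := by
    have h1 : ‖x‖ ≤ 1 := by simpa using hx
    have h2 : ‖y‖ ≤ 1 := by simpa using hs' hy
    linarith [norm_sub_le x y]
  refine lt_of_pow_lt_pow_left₀ 2 hε.le ?_
  calc ‖P (x - y)‖ ^ 2 = (⟪P (P (x - y)), x - y⟫_ℂ).re := by
        rw [← inner_self_eq_norm_sq (𝕜 := ℂ)]
        exact congrArg Complex.re (hP (P (x - y)) (x - y)).symm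
    _ ≤ ‖⟪P (P (x - y)), x - y⟫_ℂ‖ := Complex.re_le_norm _
    _ ≤ ‖P (P (x - y))‖ * ‖x - y‖ := norm_inner_le_norm _ _
    _ ≤ ‖P (P (x - y))‖ * 2 := by gcongr
    _ < ε ^ 2 / 2 * 2 := by gcongr; exact hxy
    _ = ε ^ 2 := by ring

theorem abs_eq_of_mul_self {S P : E →L[ℂ] E} (hP : 0 ≤ P) (h : P * P = star S * S) :
    CFC.abs S = P :=
  (CFC.sqrt_eq_iff _ _ (star_mul_self_nonneg S) hP).2 h

/-- By uniqueness of positive square roots `P = |S|`, and `|S| - S` is twice the negative part of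
`S`. -/
theorem le_of_mul_self_eq {S P : E →L[ℂ] E} (hS : IsSelfAdjoint S) (hP : 0 ≤ P)
    (h : P * P = S * S) : S ≤ P := by
  have habs : CFC.abs S = P := abs_eq_of_mul_self hP (by rw [hS.star_eq, h])
  rw [← habs, ← sub_nonneg, CFC.abs_sub_self _ hS]
  exact nsmul_nonneg (CFC.negPart_nonneg _) 2

theorem singularValue_of_nonneg {T : E →L[ℂ] E} (hT : 0 ≤ T) (j : ℕ) :
    singularValue T j = sSup {t : ℝ | 0 < t ∧ (j : Cardinal) ≤ eigenvalueCount T t} := by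
  rw [singularValue, abs_eq_of_mul_self hT (by rw [hT.isSelfAdjoint.star_eq])]

omit [CompleteSpace E] in
theorem isSymmetric_of_nonneg {P : E →L[ℂ] E} (hP : 0 ≤ P) : (P : E →ₗ[ℂ] E).IsSymmetric :=
  ((ContinuousLinearMap.nonneg_iff_isPositive P).1 hP).isSymmetric

theorem isCompactOperator_abs {A : E →L[ℂ] E} (hA : IsCompactOperator A) :
    IsCompactOperator (CFC.abs A : E →L[ℂ] E) := by
  refine isCompactOperator_of_mul_self (isSymmetric_of_nonneg (CFC.abs_nonneg A)) ?_
  rw [CFC.abs_mul_abs]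
  exact hA.clm_comp (star A)

theorem isCompactOperator_abs_star {A : E →L[ℂ] E} (hA : IsCompactOperator A) :
    IsCompactOperator (CFC.abs (star A) : E →L[ℂ] E) := by
  refine isCompactOperator_of_mul_self (isSymmetric_of_nonneg (CFC.abs_nonneg _)) ?_
  rw [CFC.abs_mul_abs, star_star]
  exact hA.comp_clm (star A)

end Forms

end SingularValueSum

namespace SingularValueSum

/-! ### Block operators on `H ⊕ H` and the eigenvalue comparison. -/

section Blocks

variable {H : Type*} [NormedAddCommGroup H] [InnerProductSpace ℂ H]

@[simp]
theorem directSum_apply (A B : H →L[ℂ] H) (w : WithLp 2 (H × H)) :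
    directSum A B w = WithLp.toLp 2 (A w.fst, B w.snd) := rfl

/-- The block off-diagonal operator `(x, y) ↦ (A y, B x)`. -/
noncomputable def offDiagonal (A B : H →L[ℂ] H) : WithLp 2 (H × H) →L[ℂ] WithLp 2 (H × H) :=
  (WithLp.prodContinuousLinearEquiv 2 ℂ H H).symm.toContinuousLinearMap ∘L
    ((A ∘L ContinuousLinearMap.snd ℂ H H).prod (B ∘L ContinuousLinearMap.fst ℂ H H)) ∘L
      (WithLp.prodContinuousLinearEquiv 2 ℂ H H).toContinuousLinearMap

@[simp]
theorem offDiagonal_apply (A B : H →L[ℂ] H) (w : WithLp 2 (H × H)) :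
    offDiagonal A B w = WithLp.toLp 2 (A w.snd, B w.fst) := rfl

theorem isCompactOperator_directSum {A B : H →L[ℂ] H} (hA : IsCompactOperator A)
    (hB : IsCompactOperator B) : IsCompactOperator (directSum A B) := by
  have h1 := (hA.comp_clm (ContinuousLinearMap.fst ℂ H H ∘L
    (WithLp.prodContinuousLinearEquiv 2 ℂ H H).toContinuousLinearMap)).clm_comp
    ((WithLp.prodContinuousLinearEquiv 2 ℂ H H).symm.toContinuousLinearMap ∘L
      ContinuousLinearMap.inl ℂ H H)
  have h2 := (hB.comp_clm (ContinuousLinearMap.snd ℂ H H ∘L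
    (WithLp.prodContinuousLinearEquiv 2 ℂ H H).toContinuousLinearMap)).clm_comp
    ((WithLp.prodContinuousLinearEquiv 2 ℂ H H).symm.toContinuousLinearMap ∘L
      ContinuousLinearMap.inr ℂ H H)
  refine (?_ : (directSum A B : WithLp 2 (H × H) → WithLp 2 (H × H)) = _) ▸ h1.add h2
  funext w
  show WithLp.toLp 2 (A w.fst, B w.snd) = WithLp.toLp 2 (A w.fst, 0) + WithLp.toLp 2 (0, B w.snd)
  simp [← WithLp.toLp_add]

theorem directSum_nonneg {A B : H →L[ℂ] H} (hA : 0 ≤ A) (hB : 0 ≤ B) : 0 ≤ directSum A B := by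
  rw [ContinuousLinearMap.nonneg_iff_isPositive] at *
  refine ⟨fun v w => ?_, fun w => ?_⟩
  · have h1 := hA.isSymmetric v.fst w.fst
    have h2 := hB.isSymmetric v.snd w.snd
    simp only [ContinuousLinearMap.coe_coe] at h1 h2
    simp [h1, h2]
  · have h1 := hA.re_inner_nonneg_left w.fst
    have h2 := hB.re_inner_nonneg_left w.snd
    rw [ContinuousLinearMap.reApplyInnerSelf_apply]
    simpa using add_nonneg h1 h2

variable [CompleteSpace H]

theorem isSelfAdjoint_offDiagonal (A : H →L[ℂ] H) :
    IsSelfAdjoint (offDiagonal (star A) A) := by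
  rw [ContinuousLinearMap.isSelfAdjoint_iff_isSymmetric]
  intro v w
  simp [ContinuousLinearMap.star_eq_adjoint, ContinuousLinearMap.adjoint_inner_left,
    ContinuousLinearMap.adjoint_inner_right, add_comm]

/-- Both operators have square `A*A ⊕ AA*`. -/
theorem offDiagonal_le_directSum_abs (A : H →L[ℂ] H) :
    offDiagonal (star A) A ≤ directSum (CFC.abs A) (CFC.abs (star A)) := by
  refine le_of_mul_self_eq (isSelfAdjoint_offDiagonal A)
    (directSum_nonneg (CFC.abs_nonneg A) (CFC.abs_nonneg (star A))) ?_
  have h1 := CFC.abs_mul_abs A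
  have h2 := CFC.abs_mul_abs (star A)
  rw [star_star] at h2
  refine ContinuousLinearMap.ext fun w => ?_
  show WithLp.toLp 2 ((CFC.abs A * CFC.abs A) w.fst, (CFC.abs (star A) * CFC.abs (star A)) w.snd) =
    WithLp.toLp 2 ((star A * A) w.fst, (A * star A) w.snd)
  rw [h1, h2]

theorem two_mul_re_inner_le (A : H →L[ℂ] H) (x y : H) :
    2 * (⟪A x, y⟫_ℂ).re ≤ (⟪CFC.abs A x, x⟫_ℂ).re + (⟪CFC.abs (star A) y, y⟫_ℂ).re := by
  have h := ((ContinuousLinearMap.le_def _ _).1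
    (offDiagonal_le_directSum_abs A)).re_inner_nonneg_left (WithLp.toLp 2 (x, y))
  have h2 : ⟪(star A) y, x⟫_ℂ = ⟪y, A x⟫_ℂ := ContinuousLinearMap.adjoint_inner_left A x y
  have h3 : (⟪y, A x⟫_ℂ).re = (⟪A x, y⟫_ℂ).re := inner_re_symm (𝕜 := ℂ) _ _
  simp [inner_sub_left, h2] at h
  linarith

theorem natCast_le_eigenvalueCount_directSum {A B : H →L[ℂ] H} (hA : IsCompactOperator A)
    (hB : IsCompactOperator B) {j : ℕ} {t : ℝ} (ht : 0 < t)
    (hj : (j : Cardinal) ≤ eigenvalueCount (CFC.abs (A + B)) t) :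
    (j : Cardinal) ≤ eigenvalueCount
      (directSum (CFC.abs A + CFC.abs B) (CFC.abs (star A) + CFC.abs (star B))) t := by
  set X := A + B with hX
  set T := directSum (CFC.abs A + CFC.abs B) (CFC.abs (star A) + CFC.abs (star B)) with hT
  have hTc : IsCompactOperator T := isCompactOperator_directSum
    ((isCompactOperator_abs hA).add (isCompactOperator_abs hB))
    ((isCompactOperator_abs_star hA).add (isCompactOperator_abs_star hB))
  have hTs : (T : WithLp 2 (H × H) →ₗ[ℂ] WithLp 2 (H × H)).IsSymmetric :=
    isSymmetric_of_nonneg (directSum_nonneg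
      (add_nonneg (CFC.abs_nonneg _) (CFC.abs_nonneg _))
      (add_nonneg (CFC.abs_nonneg _) (CFC.abs_nonneg _)))
  have hPs := isSymmetric_of_nonneg (CFC.abs_nonneg X)
  have hXX : ∀ u v, ⟪X u, X v⟫_ℂ = ⟪CFC.abs X u, CFC.abs X v⟫_ℂ := by
    intro u v
    calc ⟪X u, X v⟫_ℂ = ⟪(star X * X) u, v⟫_ℂ :=
          (ContinuousLinearMap.adjoint_inner_left X v (X u)).symm
      _ = ⟪CFC.abs X (CFC.abs X u), v⟫_ℂ := by rw [← CFC.abs_mul_abs, mul_apply_eq_comp]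
      _ = ⟪CFC.abs X u, CFC.abs X v⟫_ℂ := hPs _ _
  -- With a polar decomposition `X = U|X|` this is `u ↦ (y, U y)` for `y = |X| u`; writing it
  -- through `u` avoids `U`. Injectivity uses `t > 0`.
  let L : eigenspaceGE (CFC.abs X) t →ₗ[ℂ] WithLp 2 (H × H) :=
    (WithLp.linearEquiv 2 ℂ (H × H)).symm.toLinearMap ∘ₗ
      (((CFC.abs X : H →L[ℂ] H) : H →ₗ[ℂ] H).prod (X : H →ₗ[ℂ] H)) ∘ₗ (eigenspaceGE (CFC.abs X) t).subtype
  have hLapp : ∀ u, L u = WithLp.toLp 2 (CFC.abs X u, X u) := fun _ => rfl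
  refine le_eigenvalueCount hTc hTs (L := L) ?_ (fun u => ?_) hj
  · rw [injective_iff_map_eq_zero]
    intro u hu
    have h0 : CFC.abs X u = 0 := congrArg (fun w : WithLp 2 (H × H) => w.fst) hu
    have h1 := le_form_of_mem_eigenspaceGE hPs u.2
    rw [h0, inner_zero_left, Complex.zero_re] at h1
    have h2 : ‖(u : H)‖ ^ 2 ≤ 0 := nonpos_of_mul_nonpos_right h1 ht
    have h3 : ‖(u : H)‖ = 0 := by nlinarith [norm_nonneg (u : H)]
    exact Subtype.ext (norm_eq_zero.1 h3)
  · set y : H := CFC.abs X u with hy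
    have hnorm : ‖L u‖ ^ 2 = 2 * ‖y‖ ^ 2 := by
      have h : ‖X u‖ ^ 2 = ‖y‖ ^ 2 := by
        rw [← inner_self_eq_norm_sq (𝕜 := ℂ), ← inner_self_eq_norm_sq (𝕜 := ℂ), hXX]
      rw [WithLp.prod_norm_sq_eq_of_L2, hLapp, WithLp.toLp_fst, WithLp.toLp_snd, h]
      ring
    -- The bound is needed at `y`, which stays in the spectral subspace by invariance.
    have h1 := le_form_of_mem_eigenspaceGE hPs (map_mem_eigenspaceGE u.2)
    have hA' := two_mul_re_inner_le A y (X u)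
    have hB' := two_mul_re_inner_le B y (X u)
    have h2 : ⟪A y, X u⟫_ℂ + ⟪B y, X u⟫_ℂ = ⟪CFC.abs X y, y⟫_ℂ := by
      rw [← inner_add_left, ← add_apply, ← hX, hXX]
    have h3 := congrArg Complex.re h2
    rw [Complex.add_re] at h3
    have h4 : (⟪T (L u), L u⟫_ℂ).re = (⟪CFC.abs A y, y⟫_ℂ).re + (⟪CFC.abs B y, y⟫_ℂ).re +
        ((⟪CFC.abs (star A) (X u), X u⟫_ℂ).re + (⟪CFC.abs (star B) (X u), X u⟫_ℂ).re) := by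
      simp [hLapp, hT, inner_add_left, ← hy]
    rw [hnorm, h4]
    linarith

end Blocks

end SingularValueSum

theorem corollary2p4 {H : Type*} [NormedAddCommGroup H] [InnerProductSpace ℂ H]
    [CompleteSpace H] [TopologicalSpace.SeparableSpace H]
    (A B : H →L[ℂ] H) (hA : IsCompactOperator A) (hB : IsCompactOperator B)
    (j : ℕ) (hj : 1 ≤ j) :
    SingularValueSum.singularValue (A + B) j ≤
      SingularValueSum.singularValue
        (SingularValueSum.directSum (CFC.abs A + CFC.abs B)
          (CFC.abs (star A) + CFC.abs (star B))) j := by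
  have hT : 0 ≤ SingularValueSum.directSum (CFC.abs A + CFC.abs B)
      (CFC.abs (star A) + CFC.abs (star B)) :=
    SingularValueSum.directSum_nonneg
      (add_nonneg (CFC.abs_nonneg _) (CFC.abs_nonneg _))
      (add_nonneg (CFC.abs_nonneg _) (CFC.abs_nonneg _))
  rw [SingularValueSum.singularValue_of_nonneg hT, SingularValueSum.singularValue]
  set T := SingularValueSum.directSum (CFC.abs A + CFC.abs B)
      (CFC.abs (star A) + CFC.abs (star B))
  rcases Set.eq_empty_or_nonempty
    {t : ℝ | 0 < t ∧ (j : Cardinal) ≤ SingularValueSum.eigenvalueCount (CFC.abs (A + B)) t}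
    with he | hne
  -- Here the left side is `0` by convention.
  · rw [he, Real.sSup_empty]
    exact Real.sSup_nonneg fun t ht => ht.1.le
  -- Boundedness needs `j ≥ 1`: for `j = 0` the set would be all of `(0, ∞)`.
  · refine csSup_le_csSup ⟨‖T‖, fun t ht => ?_⟩ hne fun t ht =>
      ⟨ht.1, SingularValueSum.natCast_le_eigenvalueCount_directSum hA hB ht.1 ht.2⟩
    refine SingularValueSum.le_norm_of_one_le_eigenvalueCount
      (SingularValueSum.isSymmetric_of_nonneg hT) (le_trans ?_ ht.2)
    exact_mod_cast hj
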